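/- Let $X$ and $Y$ be smooth varieties over $\mathbb{C}$ (integral separated schemes of finite type and smooth over $\mathbb{C}$), and let $\pi: X \to Y$ be a finite morphism over $\mathbb{C}$ (for example a finite covering, such as a cyclic covering of degree $d$). Let $E$ be a coherent sheaf on $X$ such that $\pi_*E$ is a vector bundle on $Y$, i.e. locally free of finite rank. Then $E$ is a vector bundle on $X$, i.e. locally free of finite rank. -/

import Mathlib

open CategoryTheory AlgebraicGeometry

/-- A smooth (complex algebraic) variety: an integral scheme that is separated, of finite type
and smooth over `Spec ℂ`. -/
structure IsSmoothVariety (X : Scheme.{0}) [X.Over (Spec (.of ℂ))] : Prop where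
  isIntegral : IsIntegral X
  isSeparated : IsSeparated (X ↘ Spec (.of ℂ))
  locallyOfFiniteType : LocallyOfFiniteType (X ↘ Spec (.of ℂ))
  quasiCompact : QuasiCompact (X ↘ Spec (.of ℂ))
  smooth : Smooth (X ↘ Spec (.of ℂ))

/-- Coherent sheaves of modules on a locally Noetherian scheme: quasi-coherent sheaves of
finite type. -/
structure IsCoherentSheaf {X : Scheme.{0}} (E : X.Modules) : Prop where
  isQuasicoherent : SheafOfModules.IsQuasicoherent (R := X.ringCatSheaf) E
  isFiniteType : SheafOfModules.IsFiniteType (R := X.ringCatSheaf) E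

/-- Vector bundles: locally free sheaves of modules of finite rank. Every point has an open
neighbourhood `U` such that the restriction of `E` to `U` is isomorphic to `𝒪_U ^ n`
for some `n : ℕ`. -/
def IsVectorBundle {X : Scheme.{0}} (E : X.Modules) : Prop :=
  ∀ x : X, ∃ U : X.Opens, x ∈ U ∧ ∃ n : ℕ,
    Nonempty (E.restrict U.ι ≅
      (SheafOfModules.free (R := (U : Scheme.{0}).ringCatSheaf) (Fin n) :
        (U : Scheme.{0}).Modules))

/-! On an affine piece, `π` is a finite map `A → B` and `E` is a `B`-module `M`, free over `A`.
Étale coordinates `k[X₁,…,Xₙ] → A` make `M` flat over the polynomial ring, so the equations `X i - C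
(a i)` of the image of a closed point `q` form a regular sequence of length `n` on `M_q`, if `M_q ≠
0`. Over a smooth `B` the maximal ideal of `B_q` also has `n` generators: if `M ≠ 0`, flatness
forces `A → B` to be injective, so the function fields form an algebraic separable extension and
have differentials of the same rank `n`. Thus `M_q` has depth as large as a regular local ring
allows, and is free.

The three pillars are `Module.free_of_isRegular_of_generators` (the depth argument),
`Algebra.Smooth.exists_generators_maximalIdeal` (regularity of `B_q`) and
`Module.flat_of_flat_of_finite_of_smooth`, which combines them. Krull dimension never appears:
generators and ranks of differentials are counted instead. Flatness and finite presentation then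
give freeness near each point. -/

/-! ### Regular sequences and freeness over local rings. -/

open IsLocalRing RingTheory.Sequence Pointwise in
/-- Modulo an element of `m` outside `m ^ 2`, the maximal ideal `m` of a local ring needs one
generator less. -/
theorem exists_generators_maximalIdeal_quotient {R : Type*} [CommRing R] [IsLocalRing R] {n : ℕ}
    (y : Fin (n + 1) → R) (hy : Ideal.span (Set.range y) = maximalIdeal R) {x : R}
    (hx : x ∈ maximalIdeal R) (hx2 : x ∉ maximalIdeal R ^ 2) [IsLocalRing (R ⧸ Ideal.span {x})] :
    ∃ z : Fin n → R ⧸ Ideal.span {x}, Ideal.span (Set.range z) = maximalIdeal _ := by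
  have hmap : (maximalIdeal R).map (Ideal.Quotient.mk (Ideal.span {x})) = maximalIdeal _ := by
    refine eq_maximalIdeal ((Ideal.map_eq_top_or_isMaximal_of_surjective _
      Ideal.Quotient.mk_surjective inferInstance).resolve_left fun h ↦ ?_)
    have := congrArg (Ideal.comap (Ideal.Quotient.mk (Ideal.span {x}))) h
    rw [Ideal.comap_map_of_surjective _ Ideal.Quotient.mk_surjective, ← RingHom.ker_eq_comap_bot,
      Ideal.mk_ker, Ideal.comap_top, sup_eq_left.mpr (by simpa)] at this
    exact Ideal.IsPrime.ne_top' this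
  obtain ⟨a, ha⟩ := (Ideal.mem_span_range_iff_exists_fun).mp (hy ▸ hx)
  obtain ⟨i, hi⟩ : ∃ i, IsUnit (a i) := by
    by_contra! h
    refine hx2 (ha ▸ Ideal.sum_mem _ fun i _ ↦ ?_)
    rw [pow_two]
    exact Ideal.mul_mem_mul (by simpa using h i) (hy ▸ Ideal.subset_span ⟨i, rfl⟩)
  refine ⟨fun j ↦ Ideal.Quotient.mk _ (y (i.succAbove j)), ?_⟩
  rw [← hmap, ← hy, Ideal.map_span, ← Set.range_comp]
  refine le_antisymm (Ideal.span_mono ?_) (Ideal.span_le.mpr ?_)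
  · rintro _ ⟨j, rfl⟩
    exact ⟨_, rfl⟩
  · rintro _ ⟨j, rfl⟩
    obtain rfl | ⟨j, rfl⟩ := i.eq_self_or_eq_succAbove j
    · have h0 : Ideal.Quotient.mk (Ideal.span {x}) (∑ l, a l * y l) = 0 := by
        rw [ha, Ideal.Quotient.eq_zero_iff_mem]
        exact Ideal.mem_span_singleton_self x
      rw [Fin.sum_univ_succAbove _ j, map_add, map_mul, map_sum, add_eq_zero_iff_eq_neg] at h0
      have hu := hi.map (Ideal.Quotient.mk (Ideal.span {x}))
      rw [Function.comp_apply, SetLike.mem_coe, ← Ideal.unit_mul_mem_iff_mem _ hu, h0]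
      refine neg_mem (Ideal.sum_mem _ fun l _ ↦ ?_)
      rw [map_mul]
      exact Ideal.mul_mem_left _ _ (Ideal.subset_span ⟨l, rfl⟩)
    · exact Ideal.subset_span ⟨j, rfl⟩

open IsLocalRing RingTheory.Sequence Pointwise Abelian in
/-- If `M` has a regular sequence of length `n + 1` in `I` and `x ∈ I` is `M`-regular,
then `M / xM` has a regular sequence of length `n` in `I`. -/
theorem exists_isRegular_quotSMulTop {R : Type u} [CommRing R] [IsNoetherianRing R]
    {M : Type u} [AddCommGroup M] [Module R M] [Module.Finite R M] {I : Ideal R}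
    (hI : I • (⊤ : Submodule R M) ≠ ⊤) {rs : List R} (mem : ∀ r ∈ rs, r ∈ I)
    (reg : IsRegular M rs) {n : ℕ} (len : rs.length = n + 1) {x : R} (hx : x ∈ I)
    (hxM : IsSMulRegular M x) :
    ∃ ss : List R, ss.length = n ∧ (∀ r ∈ ss, r ∈ I) ∧ IsRegular (QuotSMulTop x M) ss := by
  have h0 : ∃ rs : List R, rs.length = n + 1 ∧ (∀ r ∈ rs, r ∈ I) ∧
    IsRegular (ModuleCat.of R M) rs := ⟨rs, len, mem, reg⟩
  -- Rees' criterion turns regular sequences into vanishing of Ext, so `x` need not be a term of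
  -- `rs`. The long exact sequence of multiplication by `x` then costs one degree.
  have h1 := ((ModuleCat.exists_isRegular_tfae I (n + 1) (ModuleCat.of R M) hI.lt_top).out 3 1).mp
    h0
  have hI' : I • (⊤ : Submodule R (QuotSMulTop x M)) ≠ ⊤ := by
    intro eq
    absurd congrArg (Submodule.comap (Submodule.mkQ _)) eq
    simpa [Submodule.comap_smul_top_of_surjective I _ (Submodule.mkQ_surjective _),
      Submodule.smul_mono_left ((Ideal.span_singleton_le_iff_mem I).mpr hx),
      ← Submodule.ideal_span_singleton_smul] using hI
  refine ((ModuleCat.exists_isRegular_tfae I n (ModuleCat.of R (QuotSMulTop x M))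
    hI'.lt_top).out 1 3).mp fun i hi ↦ ?_
  have zero1 := AddCommGrpCat.isZero_of_iff_subsingleton.mpr (h1 i (by omega))
  have zero2 := AddCommGrpCat.isZero_of_iff_subsingleton.mpr (h1 (i + 1) (by omega))
  exact AddCommGrpCat.subsingleton_of_isZero <| ShortComplex.Exact.isZero_of_both_zeros
    ((Ext.covariant_sequence_exact₃' _
      (IsSMulRegular.smulShortComplex_shortExact (M := ModuleCat.of R M) hxM)) i (i + 1) rfl)
    (zero1.eq_zero_of_src _) (zero2.eq_zero_of_tgt _)

open IsLocalRing RingTheory.Sequence Pointwise in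
/-- A finite module over a Noetherian local ring whose maximal ideal has `n` generators is free
as soon as it has a regular sequence of length `n`. -/
theorem Module.free_of_isRegular_of_generators {n : ℕ} {R : Type u} [CommRing R]
    [IsLocalRing R] [IsNoetherianRing R] {M : Type u} [AddCommGroup M] [Module R M]
    [Module.Finite R M] (y : Fin n → R) (hy : Ideal.span (Set.range y) = maximalIdeal R)
    (rs : List R) (len : rs.length = n) (mem : ∀ r ∈ rs, r ∈ maximalIdeal R)
    (reg : IsRegular M rs) : Module.Free R M := by
  -- The field case is split off because the choice of `x` below needs `m ≠ m ^ 2`, which by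
  -- Nakayama means `m ≠ 0`.
  by_cases hbot : maximalIdeal R = ⊥
  · let := (isField_iff_maximalIdeal_eq.mpr hbot).toField
    infer_instance
  induction n generalizing R M with
  | zero => exact absurd (by simpa using hy.symm) hbot
  | succ n ih =>
    have hM : maximalIdeal R • (⊤ : Submodule R M) ≠ ⊤ := by
      have := reg.nontrivial
      exact (Submodule.top_ne_ideal_smul_of_le_jacobson_annihilator
        (maximalIdeal_le_jacobson _)).symm
    obtain ⟨x, hx, hx2, hxM⟩ : ∃ x ∈ maximalIdeal R, x ∉ maximalIdeal R ^ 2 ∧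
        IsSMulRegular M x := by
      by_contra! h
      have hsub : (maximalIdeal R : Set R) ⊆
          ⋃ p ∈ insert (maximalIdeal R ^ 2) (associatedPrimes R M), (p : Set R) := by
        intro x hx
        rw [Set.biUnion_insert]
        by_cases hx2 : x ∈ maximalIdeal R ^ 2
        · exact .inl hx2
        · exact .inr (by rw [biUnion_associatedPrimes_eq_compl_regular]; exact h x hx hx2)
      -- Prime avoidance tolerates two ideals that need not be prime; `m ^ 2` fills both slots.
      obtain ⟨p, hp, hle⟩ := (Ideal.subset_union_prime_finite
        ((associatedPrimes.finite R M).insert _) (f := id) (maximalIdeal R ^ 2)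
        (maximalIdeal R ^ 2) fun p hp h1 _ ↦
          (((Set.mem_insert_iff.mp hp).resolve_left h1).isPrime)).1 hsub
      obtain rfl | hp := Set.mem_insert_iff.mp hp
      · refine hbot (Submodule.eq_bot_of_le_smul_of_le_jacobson_bot (maximalIdeal R) _
          (IsNoetherian.noetherian _) ?_ (maximalIdeal_le_jacobson _))
        simpa [pow_two] using hle
      · obtain ⟨r, rs', rfl⟩ := List.exists_cons_of_length_eq_add_one len
        have hr := ((isRegular_cons_iff M r rs').mp reg).1
        have : r ∈ ⋃ p ∈ associatedPrimes R M, (p : Set R) :=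
          Set.mem_biUnion hp (hle (mem r (by simp)))
        rw [biUnion_associatedPrimes_eq_compl_regular] at this
        exact this hr
    obtain ⟨ss, lens, mems, regs⟩ := exists_isRegular_quotSMulTop hM mem reg len hx hxM
    have hne : Ideal.span {x} ≠ (⊤ : Ideal R) := by
      simpa [Ideal.span_singleton_eq_top] using hx
    have : Nontrivial (R ⧸ Ideal.span {x}) := Ideal.Quotient.nontrivial_iff.mpr hne
    have : IsLocalRing (R ⧸ Ideal.span {x}) :=
      .of_surjective' (Ideal.Quotient.mk _) Ideal.Quotient.mk_surjective
    have : Module.Finite (R ⧸ Ideal.span {x}) (QuotSMulTop x M) :=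
      .of_restrictScalars_finite R _ _
    have hmem : (x : R) ∈ (⊥ : Ideal R).jacobson := maximalIdeal_le_jacobson _ hx
    obtain ⟨z, hz⟩ := exists_generators_maximalIdeal_quotient y hy hx hx2
    have := Module.finitePresentation_of_finite R M
    -- A basis of `M / xM` lifts to a surjection onto `M`; as `x` is `M`-regular, its kernel `K`
    -- satisfies `K = xK`, so `K = 0` by Nakayama.
    rw [← Module.free_quotSMulTop_iff_free R M hmem hxM]
    by_cases hbot' : maximalIdeal (R ⧸ Ideal.span {x}) = ⊥
    · let := (isField_iff_maximalIdeal_eq.mpr hbot').toField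
      infer_instance
    refine ih z hz (ss.map (Ideal.Quotient.mk _)) (by simpa) ?_ ?_ hbot'
    · intro r hr
      obtain ⟨s, hs, rfl⟩ := List.mem_map.mp hr
      exact (eq_maximalIdeal (Ideal.comap_isMaximal_of_surjective (Ideal.Quotient.mk (Ideal.span {x}))
        Ideal.Quotient.mk_surjective (K := maximalIdeal _))).ge (mems s hs)
    · have h : List.Forall₂ (fun (r : R) (s : R ⧸ Ideal.span {x}) ↦ ∀ m : QuotSMulTop x M,
          AddEquiv.refl (QuotSMulTop x M) (r • m) = s • AddEquiv.refl (QuotSMulTop x M) m) ss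
          (ss.map (Ideal.Quotient.mk (Ideal.span {x}))) :=
        List.forall₂_map_right_iff.mpr (List.forall₂_same.mpr fun _ _ _ ↦ rfl)
      exact (AddEquiv.isRegular_congr (M := QuotSMulTop x M) (M₂ := QuotSMulTop x M)
        (e := AddEquiv.refl (QuotSMulTop x M)) h).mp regs

/-! ### Equations of a rational point of affine space. -/

open MvPolynomial RingTheory.Sequence in
/-- The substitution `X j ↦ C (a j)` for `j ∈ s`. -/
noncomputable def MvPolynomial.evalPartial {k σ : Type*} [CommRing k] (a : σ → k) (s : Set σ)
    [DecidablePred (· ∈ s)] : MvPolynomial σ k →ₐ[k] MvPolynomial σ k :=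
  aeval fun j ↦ if j ∈ s then C (a j) else X j

-- The substitution is the identity modulo the ideal and kills its generators. Membership in the
-- ideal thus becomes a vanishing statement in a polynomial ring.
open MvPolynomial in
theorem MvPolynomial.evalPartial_eq_zero_iff {k σ : Type*} [CommRing k] (a : σ → k) (s : Set σ)
    [DecidablePred (· ∈ s)] (p : MvPolynomial σ k) :
    evalPartial a s p = 0 ↔ p ∈ Ideal.span ((fun j ↦ X j - C (a j)) '' s) := by
  constructor
  · intro h
    have key : ∀ q : MvPolynomial σ k,
        Ideal.Quotient.mkₐ k (Ideal.span ((fun j ↦ X j - C (a j)) '' s)) (evalPartial a s q) =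
        Ideal.Quotient.mkₐ k _ q := by
      intro q
      rw [← AlgHom.comp_apply]
      congr 1
      ext j
      simp only [evalPartial, AlgHom.comp_apply, aeval_X]
      split_ifs with hj
      · rw [eq_comm, Ideal.Quotient.mkₐ_eq_mk, Ideal.Quotient.mk_eq_mk_iff_sub_mem]
        exact Ideal.subset_span ⟨j, hj, rfl⟩
      · rfl
    have := key p
    rwa [h, map_zero, eq_comm, Ideal.Quotient.mkₐ_eq_mk, Ideal.Quotient.eq_zero_iff_mem] at this
  · intro h
    have : Ideal.span ((fun j ↦ X j - C (a j)) '' s) ≤ RingHom.ker (evalPartial a s) := by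
      rw [Ideal.span_le]
      rintro _ ⟨j, hj, rfl⟩
      simp [evalPartial, hj, algHom_C]
    exact this h

-- Substituting the first `i` coordinates embeds the `i`-th quotient in the polynomial ring, a
-- domain, where `X i - C (a i)` survives.
open MvPolynomial RingTheory.Sequence in
theorem MvPolynomial.isWeaklyRegular_X_sub_C {k : Type*} [CommRing k] [IsDomain k] {n : ℕ} (a : Fin n → k) :
    IsWeaklyRegular (MvPolynomial (Fin n) k) (List.ofFn fun i ↦ X i - C (a i)) := by
  classical
  rw [isWeaklyRegular_iff]
  intro i hi
  rw [List.length_ofFn] at hi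
  have hI : Ideal.ofList ((List.ofFn fun i ↦ X i - C (a i)).take i) =
      Ideal.span ((fun j : Fin n ↦ (X j - C (a j) : MvPolynomial (Fin n) k)) '' {j | j.1 < i}) := by
    refine congrArg Ideal.span (Set.ext fun p ↦ ?_)
    simp only [List.mem_take_iff_getElem, List.getElem_ofFn, Set.mem_ofPred_eq, Set.mem_image]
    constructor
    · rintro ⟨j, hj, rfl⟩
      exact ⟨⟨j, by simp at hj; omega⟩, by simp at hj; exact hj.1, rfl⟩
    · rintro ⟨j, hj, rfl⟩
      exact ⟨j, by simp [hj], rfl⟩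
  rw [isSMulRegular_iff_right_eq_zero_of_smul]
  intro p hp
  obtain ⟨p, rfl⟩ := Submodule.Quotient.mk_surjective _ p
  rw [← Submodule.Quotient.mk_smul, Submodule.Quotient.mk_eq_zero, hI, smul_eq_mul, smul_eq_mul,
    Ideal.mul_top, ← evalPartial_eq_zero_iff, map_mul] at hp
  rw [Submodule.Quotient.mk_eq_zero, hI, smul_eq_mul, Ideal.mul_top, ← evalPartial_eq_zero_iff]
  simp only [List.getElem_ofFn] at hp
  refine (mul_eq_zero.mp hp).resolve_left fun h ↦ ?_
  -- The `i`-th variable is not substituted, so this derivative would give `1 = 0`.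
  have := congrArg (pderiv ⟨i, hi⟩) h
  simp [evalPartial, algHom_C] at this

open MvPolynomial in
theorem MvPolynomial.span_X_sub_C_eq_ker_aeval {k σ : Type*} [CommRing k] (a : σ → k) :
    Ideal.span (Set.range fun i ↦ X i - C (a i)) =
      RingHom.ker (aeval a : MvPolynomial σ k →ₐ[k] k) := by
  classical
  ext p
  rw [← Set.image_univ, ← evalPartial_eq_zero_iff, RingHom.mem_ker]
  have : evalPartial a Set.univ p = C (aeval a p) := by
    have : evalPartial a Set.univ = (Algebra.ofId k (MvPolynomial σ k)).comp (aeval a) := by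
      ext j
      simp [evalPartial]
    exact DFunLike.congr_fun this p
  rw [this, C_eq_zero]

/-! ### Étale coordinates and local rings of smooth algebras. -/

/-- The differentials `dX i` remain a basis after formally étale base change. The number of
coordinates is therefore an invariant of `L` over `k`, comparable between `A` and `B`. -/
theorem Algebra.finrank_kaehlerDifferential_of_formallyEtale_mvPolynomial {k L : Type*} [Field k]
    [Field L] {n : ℕ} [Algebra k L] [Algebra (MvPolynomial (Fin n) k) L]
    [IsScalarTower k (MvPolynomial (Fin n) k) L] [FormallyEtale (MvPolynomial (Fin n) k) L] :
    Module.finrank L (Ω[L⁄k]) = n := by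
  rw [← (KaehlerDifferential.tensorKaehlerEquivOfFormallyEtale k
    (MvPolynomial (Fin n) k) L).finrank_eq,
    Module.finrank_eq_card_basis ((KaehlerDifferential.mvPolynomialBasis k (Fin n)).baseChange L),
    Fintype.card_fin]

-- Reduces to the case of a local homomorphism by factoring through the localization of `R` at the
-- contracted prime.
open IsLocalRing in
theorem Algebra.FormallyUnramified.map_under_maximalIdeal {R S : Type*} [CommRing R] [CommRing S]
    [IsLocalRing S] [Algebra R S] [FormallyUnramified R S] [EssFiniteType R S] :
    ((maximalIdeal S).under R).map (algebraMap R S) = maximalIdeal S := by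
  set p := (maximalIdeal S).under R with hp
  let f : Localization.AtPrime p →+* S := IsLocalization.lift (M := p.primeCompl)
    (g := algebraMap R S) fun x ↦ not_not.mp x.2
  algebraize [f]
  have : IsScalarTower R (Localization.AtPrime p) S :=
    .of_algebraMap_eq fun x ↦ (IsLocalization.lift_eq _ x).symm
  have : FormallyUnramified (Localization.AtPrime p) S := .of_restrictScalars R _ _
  have : EssFiniteType (Localization.AtPrime p) S := .of_comp R _ _
  have : IsLocalHom (algebraMap (Localization.AtPrime p) S) := by
    refine ((local_hom_TFAE (algebraMap (Localization.AtPrime p) S)).out 0 2).mpr ?_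
    rw [← Localization.AtPrime.map_eq_maximalIdeal, Ideal.map_map, ← IsScalarTower.algebraMap_eq,
      Ideal.map_le_iff_le_comap]
  rw [← FormallyUnramified.map_maximalIdeal (R := Localization.AtPrime p),
    ← Localization.AtPrime.map_eq_maximalIdeal, Ideal.map_map, ← IsScalarTower.algebraMap_eq]

open MvPolynomial in
theorem MvPolynomial.exists_eq_span_X_sub_C {k σ κ : Type*} [Field k] [CommRing κ] [Nontrivial κ]
    [Algebra k κ]
    (hk : Function.Surjective (algebraMap k κ)) (f : MvPolynomial σ k →ₐ[k] κ) :
    ∃ a : σ → k, RingHom.ker f = Ideal.span (Set.range fun i ↦ X i - C (a i)) := by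
  choose a ha using fun i ↦ hk (f (X i))
  refine ⟨a, ?_⟩
  have hmax : (Ideal.span (Set.range fun i ↦ X i - C (a i) : Set (MvPolynomial σ k))).IsMaximal := by
    rw [span_X_sub_C_eq_ker_aeval]
    exact RingHom.ker_isMaximal_of_surjective _ fun x ↦ ⟨C x, by simp⟩
  refine (hmax.eq_of_le (RingHom.ker_ne_top _) ?_).symm
  rw [Ideal.span_le]
  rintro _ ⟨i, rfl⟩
  simp [ha, algHom_C]

theorem Ideal.IsMaximal.surjective_algebraMap_quotient {k B : Type*} [Field k] [IsAlgClosed k]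
    [CommRing B] [Algebra k B] [Algebra.FiniteType k B] (q : Ideal B) [q.IsMaximal] :
    Function.Surjective (algebraMap k (B ⧸ q)) := by
  let := Ideal.Quotient.field q
  have : Module.Finite k (B ⧸ q) := finite_of_finite_type_of_isJacobsonRing k (B ⧸ q)
  exact IsAlgClosed.algebraMap_bijective_of_isIntegral.surjective

-- Applied both to the local ring at a closed point and to the function field, so that one `n`
-- serves both.
open IsLocalRing MvPolynomial in
theorem Algebra.exists_formallyEtale_mvPolynomial_of_isUnit {k B T : Type*} [CommRing k] [CommRing B]
    [Algebra k B] {n : ℕ} {f : B} (g : MvPolynomial (Fin n) k →ₐ[k] Localization.Away f)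
    (hg : g.Etale) [CommRing T] [Algebra k T] [Algebra B T] [IsScalarTower k B T]
    (M : Submonoid B) [IsLocalization M T] (hf : IsUnit (algebraMap B T f)) :
    ∃ φ : MvPolynomial (Fin n) k →ₐ[k] T, φ.toRingHom.FormallyEtale := by
  let h : Localization.Away f →ₐ[B] T :=
    { IsLocalization.Away.lift f hf with commutes' := IsLocalization.Away.lift_eq f hf }
  algebraize [g.toRingHom, h.toRingHom, h.toRingHom.comp g.toRingHom]
  have : IsScalarTower B (Localization.Away f) T := .of_algebraMap_eq fun x ↦ (h.commutes x).symm
  have : FormallyEtale B (Localization.Away f) := .of_isLocalization (.powers f)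
  have : FormallyEtale B T := .of_isLocalization M
  have : FormallyEtale (Localization.Away f) T := .of_restrictScalars (R := B)
  have : FormallyEtale (MvPolynomial (Fin n) k) T := .comp _ (Localization.Away f) _
  exact ⟨(h.restrictScalars k).comp g, this⟩

open IsLocalRing MvPolynomial in
/-- The local ring of a smooth variety at a closed point: the maximal ideal has as many generators
as the rank of the differentials of the function field. -/
theorem Algebra.Smooth.exists_generators_maximalIdeal {k B : Type u} [Field k] [IsAlgClosed k]
    [CommRing B] [IsDomain B] [Algebra k B] [Algebra.Smooth k B] (q : Ideal B) [q.IsMaximal] :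
    ∃ y : Fin (Module.finrank (FractionRing B) (Ω[FractionRing B⁄k])) → Localization.AtPrime q,
      Ideal.span (Set.range y) = maximalIdeal (Localization.AtPrime q) := by
  obtain ⟨f, hf, hC⟩ := IsSmoothAt.exists_notMem_isStandardSmooth k q
  obtain ⟨ι, σ, _, _, ⟨P⟩⟩ := hC.out
  have : IsStandardSmoothOfRelativeDimension P.dimension k (Localization.Away f) :=
    ⟨ι, σ, _, inferInstance, P, rfl⟩
  obtain ⟨g, hg⟩ :=
    IsStandardSmoothOfRelativeDimension.exists_etale_mvPolynomial P.dimension k (Localization.Away f)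
  obtain ⟨φ, hφ⟩ := exists_formallyEtale_mvPolynomial_of_isUnit g hg (T := Localization.AtPrime q)
    q.primeCompl (IsLocalization.map_units (M := q.primeCompl) _ ⟨f, hf⟩)
  obtain ⟨ψ, hψ⟩ := exists_formallyEtale_mvPolynomial_of_isUnit g hg (T := FractionRing B)
    (nonZeroDivisors B) (IsUnit.mk0 _ fun h ↦ hf (by
      rw [IsFractionRing.to_map_eq_zero_iff.mp h]; exact q.zero_mem))
  have hn : Module.finrank (FractionRing B) (Ω[FractionRing B⁄k]) = P.dimension := by
    algebraize [ψ.toRingHom]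
    have : IsScalarTower k (MvPolynomial (Fin P.dimension) k) (FractionRing B) :=
      .of_algebraMap_eq fun x ↦ (ψ.commutes x).symm
    exact finrank_kaehlerDifferential_of_formallyEtale_mvPolynomial
  rw [hn]
  have hκ : Function.Surjective (algebraMap k (ResidueField (Localization.AtPrime q))) := by
    have h1 := (Ideal.bijective_algebraMap_quotient_residueField q).surjective.comp
      (Ideal.IsMaximal.surjective_algebraMap_quotient (k := k) q)
    convert h1
    exact congrArg DFunLike.coe (IsScalarTower.algebraMap_eq k (B ⧸ q) q.ResidueField)
  obtain ⟨a, ha⟩ := exists_eq_span_X_sub_C hκ ((IsScalarTower.toAlgHom k _ _).comp φ)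
  algebraize [φ.toRingHom]
  have : EssFiniteType k (Localization.AtPrime q) := .comp _ B _
  have : IsScalarTower k (MvPolynomial (Fin P.dimension) k) (Localization.AtPrime q) :=
      .of_algebraMap_eq fun x ↦ (φ.commutes x).symm
  have : EssFiniteType (MvPolynomial (Fin P.dimension) k) (Localization.AtPrime q) :=
    .of_comp k _ _
  -- The residue field is `k`, so the contracted ideal is that of a rational point; its `n`
  -- generators generate the maximal ideal upstairs.
  have h := FormallyUnramified.map_under_maximalIdeal (R := MvPolynomial (Fin P.dimension) k)
    (S := Localization.AtPrime q)
  have hker : (maximalIdeal (Localization.AtPrime q)).under (MvPolynomial (Fin P.dimension) k) =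
    Ideal.span (Set.range fun i ↦ X i - C (a i)) := by
    rw [← ha]
    ext p
    simp [RingHom.algebraMap_toAlgebra]
  rw [hker, Ideal.map_span, ← Set.range_comp] at h
  exact ⟨_, h⟩

-- The fraction field of `B` is algebraic over that of `A`, hence separable in characteristic zero
-- and formally étale; so coordinates on `A` are also coordinates for the function field of `B`.
open MvPolynomial in
theorem Algebra.finrank_kaehlerDifferential_fractionRing_of_finite {k A B : Type*} [Field k]
    [CharZero k] [CommRing A] [IsDomain A] [CommRing B] [IsDomain B] [Algebra k A] [Algebra k B]
    [Algebra A B] [IsScalarTower k A B] [FaithfulSMul A B] [Module.Finite A B] {n : ℕ}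
    (g : MvPolynomial (Fin n) k →ₐ[k] A) (hg : g.Etale) :
    Module.finrank (FractionRing B) (Ω[FractionRing B⁄k]) = n := by
  let := FractionRing.liftAlgebra A (FractionRing B)
  have := FractionRing.isScalarTower_liftAlgebra A (FractionRing B)
  have : Algebra.IsAlgebraic B (FractionRing B) :=
    (IsFractionRing.comap_isAlgebraic_iff (K := FractionRing B)).mpr inferInstance
  have : Algebra.IsAlgebraic A (FractionRing B) := .trans A B _
  have : Algebra.IsAlgebraic (FractionRing A) (FractionRing B) :=
    (IsFractionRing.comap_isAlgebraic_iff (A := A)).mp this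
  have : CharZero (FractionRing A) := charZero_of_injective_algebraMap (algebraMap k _).injective
  have : FormallyEtale (FractionRing A) (FractionRing B) := .of_isSeparable _ _
  have : FormallyEtale A (FractionRing A) := .of_isLocalization (nonZeroDivisors A)
  have : FormallyEtale A (FractionRing B) := .comp A (FractionRing A) _
  algebraize [g.toRingHom, (algebraMap A (FractionRing B)).comp g.toRingHom]
  have : FormallyEtale (MvPolynomial (Fin n) k) (FractionRing B) := .comp _ A _
  have : IsScalarTower k (MvPolynomial (Fin n) k) (FractionRing B) :=
    .of_algebraMap_eq fun x ↦ by
      rw [IsScalarTower.algebraMap_apply k A (FractionRing B), ← g.commutes]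
      rfl
  exact finrank_kaehlerDifferential_of_formallyEtale_mvPolynomial

/-! ### The theorem for modules. -/

open MvPolynomial RingTheory.Sequence in
/-- Let `A → B` be a finite map of smooth domains over an algebraically closed field of
characteristic zero. A finite `B`-module which is flat over `A` is flat over `B`. -/
theorem Module.flat_of_flat_of_finite_of_smooth {k A B M : Type u} [Field k] [IsAlgClosed k]
    [CharZero k] [CommRing A] [IsDomain A] [CommRing B] [IsDomain B] [Algebra k A] [Algebra k B]
    [Algebra A B] [IsScalarTower k A B] [Module.Finite A B] [Algebra.Smooth k B] {n : ℕ}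
    (g : MvPolynomial (Fin n) k →ₐ[k] A) (hg : g.Etale) [AddCommGroup M] [Module A M] [Module B M]
    [IsScalarTower A B M] [Module.Finite B M] [Module.Flat A M] : Module.Flat B M := by
  nontriviality M
  obtain ⟨m, hm⟩ := exists_ne (0 : M)
  -- A nonzero flat module over a domain is torsion-free, while an element of the kernel of `A → B`
  -- annihilates `M`.
  have : FaithfulSMul A B := by
    refine (faithfulSMul_iff_algebraMap_injective A B).mpr
      ((injective_iff_map_eq_zero _).mpr fun a ha ↦ ?_)
    by_contra h0
    refine hm ((Module.Flat.isSMulRegular_of_nonZeroDivisors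
      (mem_nonZeroDivisors_of_ne_zero h0)).right_eq_zero_of_smul ?_)
    rw [← algebraMap_smul B a m, ha, zero_smul]
  have hn := Algebra.finrank_kaehlerDifferential_fractionRing_of_finite (B := B) g hg
  refine Module.flat_of_localized_maximal M fun q hq ↦ ?_
  rcases subsingleton_or_nontrivial (LocalizedModule q.primeCompl M) with _ | _
  · infer_instance
  obtain ⟨y, hy⟩ := Algebra.Smooth.exists_generators_maximalIdeal (k := k) q
  have hmax := hn ▸ (⟨y, hy⟩ : ∃ y, Ideal.span (Set.range y) = _)
  obtain ⟨y, hy⟩ := hmax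
  -- The point `a` is the image of `q` in affine space.
  obtain ⟨a, ha⟩ := exists_eq_span_X_sub_C
    (Ideal.IsMaximal.surjective_algebraMap_quotient (k := k) q)
    (((Ideal.Quotient.mkₐ k q).comp (IsScalarTower.toAlgHom k A B)).comp g)
  algebraize [g.toRingHom]
  let := Module.compHom M (algebraMap (MvPolynomial (Fin n) k) A)
  have : IsScalarTower (MvPolynomial (Fin n) k) A M := .of_compHom ..
  have : Module.Flat (MvPolynomial (Fin n) k) M := .trans _ A M
  have hreg : IsWeaklyRegular M (List.ofFn fun i ↦ (X i - C (a i) : MvPolynomial (Fin n) k)) :=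
    ((TensorProduct.lid _ M).isWeaklyRegular_congr _).mp
      ((isWeaklyRegular_X_sub_C a).isWeaklyRegular_rTensor (M₂ := M))
  rw [← isWeaklyRegular_map_algebraMap_iff A, ← isWeaklyRegular_map_algebraMap_iff B] at hreg
  have hmem : ∀ r ∈ ((List.ofFn fun i ↦ (X i - C (a i) : MvPolynomial (Fin n) k)).map
      (algebraMap _ A)).map (algebraMap A B), r ∈ q := by
    simp only [List.map_ofFn, List.mem_ofFn]
    rintro _ ⟨i, rfl⟩
    have : X i - C (a i) ∈ Ideal.span (Set.range fun i ↦ X i - C (a i)) :=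
      Ideal.subset_span ⟨i, rfl⟩
    rw [← ha] at this
    exact Ideal.Quotient.eq_zero_iff_mem.mp this
  -- The sequence lies in `q` and `M_q` is nonzero, so weak regularity becomes regularity.
  have hreg' := hreg.isRegular_of_isLocalizedModule_of_mem (Localization.AtPrime q) q
    (LocalizedModule.mkLinearMap q.primeCompl M) hmem
  have := IsLocalization.isNoetherianRing q.primeCompl (Localization.AtPrime q)
    (Algebra.FiniteType.isNoetherianRing k B)
  have : Module.Free (Localization.AtPrime q) (LocalizedModule q.primeCompl M) := by
    refine Module.free_of_isRegular_of_generators y hy _ (by simp) (fun r hr ↦ ?_) hreg'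
    obtain ⟨s, hs, rfl⟩ := List.mem_map.mp hr
    exact (IsLocalization.AtPrime.to_map_mem_maximal_iff _ q s).mpr (hmem s hs)
  have : Module.Flat B (Localization.AtPrime q) := IsLocalization.flat _ q.primeCompl
  exact .trans B (Localization.AtPrime q) _

/-! ### Free sheaves and modules of sections over affine opens. -/

namespace AlgebraicGeometry.Scheme.Modules
/-- Restriction along an open immersion sends free modules to free modules. -/
noncomputable def restrictFreeIso {X Y : Scheme.{u}} (f : X ⟶ Y)
    [IsOpenImmersion f] (I : Type u) :
    restrict (SheafOfModules.free (R := Y.ringCatSheaf) I : Y.Modules) f ≅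
      (SheafOfModules.free (R := X.ringCatSheaf) I : X.Modules) :=
  letI e : (∐ fun _ : I ↦ restrict (SheafOfModules.unit Y.ringCatSheaf : Y.Modules) f) ≅
      ∐ fun _ : I ↦ (SheafOfModules.unit X.ringCatSheaf : X.Modules) :=
    Limits.Sigma.mapIso fun _ ↦ restrictUnitIso f
  (Limits.PreservesCoproduct.iso (restrictFunctor f)
    fun _ : I ↦ (SheafOfModules.unit Y.ringCatSheaf : Y.Modules)) ≪≫ e

theorem nonempty_iso_free_of_linearEquiv {R : CommRingCat.{u}}
    (E : (Spec R).Modules) [hE : E.IsQuasicoherent] (I : Type u)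
    (e : Γ(E, ⊤) ≃ₗ[R] (I →₀ R)) :
    Nonempty (E ≅ (SheafOfModules.free (R := (Spec R).ringCatSheaf) I : (Spec R).Modules)) := by
  have := isIso_fromTildeΓ_of_isQuasicoherent E
  exact ⟨(asIso E.fromTildeΓ).symm ≪≫ (tilde.functor R).mapIso
    (LinearEquiv.toModuleIso e) ≪≫ tildeFinsupp I⟩
 
theorem nonempty_linearEquiv_of_iso_free {R : CommRingCat.{u}} (E : (Spec R).Modules)
    (I : Type u) (e : E ≅ (SheafOfModules.free (R := (Spec R).ringCatSheaf) I : (Spec R).Modules)) :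
    Nonempty (Γ(E, ⊤) ≃ₗ[R] (I →₀ R)) :=
  ⟨((tilde.isoTop (ModuleCat.of R (I →₀ R))) ≪≫
    (moduleSpecΓFunctor.mapIso (tildeFinsupp I ≪≫ e.symm))).symm.toLinearEquiv⟩

/-- Sections over `W = j(V)`, computed on the restriction along `j`. -/
noncomputable def restrictAddEquiv {X Y : Scheme.{u}} (j : X ⟶ Y) [IsOpenImmersion j] (E : Y.Modules)
    {V : X.Opens} {W : Y.Opens} (h : W = j ''ᵁ V) :
    Γ(E.restrict j, V) ≃+ Γ(E, W) :=
  (E.restrictAppIso j V ≪≫ E.presheaf.mapIso (eqToIso h).op).addCommGroupIsoToAddEquiv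

theorem restrictAddEquiv_smul {X Y : Scheme.{u}} (j : X ⟶ Y) [IsOpenImmersion j] (E : Y.Modules)
    {V : X.Opens} {W : Y.Opens} (h : W = j ''ᵁ V) (r : Γ(X, V)) (x : Γ(E.restrict j, V)) :
    restrictAddEquiv j E h (r • x) =
      Y.presheaf.map (eqToHom h).op ((j.appIso V).inv r) • restrictAddEquiv j E h x := by
  subst h
  simp [restrictAddEquiv]

theorem restrictAddEquiv_fromSpec_smul {X : Scheme.{u}} (E : X.Modules) {U : X.Opens}
    (hU : IsAffineOpen U) {V : (Spec Γ(X, U)).Opens} {W : X.Opens} (h : W = hU.fromSpec ''ᵁ V)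
    (hW : W ≤ U) (r : Γ(X, U)) (x : Γ(E.restrict hU.fromSpec, V)) :
    restrictAddEquiv hU.fromSpec E h (r • x) =
      X.presheaf.map (homOfLE hW).op r • restrictAddEquiv hU.fromSpec E h x := by
  rw [smul_Spec_def, restrictAddEquiv_smul]
  congr 1
  subst h
  simp only [← ConcreteCategory.comp_apply]
  congr 2
  have h : (ΓSpecIso Γ(X, U)).inv ≫ (hU.fromSpec.appIso ⊤).inv =
      X.presheaf.map (homOfLE (by simp)).op := by
    rw [Iso.comp_inv_eq, Scheme.Hom.appIso_hom, Scheme.Hom.naturality_assoc, hU.fromSpec_app_self]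
    simp [← Functor.map_comp]
  simp only [eqToHom_refl, op_id, Category.assoc, Scheme.Hom.appIso_inv_naturality,
    CategoryTheory.Functor.map_id, Category.comp_id]
  rw [reassoc_of% h, ← Functor.map_comp]
  rfl

theorem nonempty_linearEquiv_fromSpec {X : Scheme.{u}} (E : X.Modules) {U : X.Opens}
    (hU : IsAffineOpen U) :
    Nonempty (Γ(E.restrict hU.fromSpec, ⊤) ≃ₗ[Γ(X, U)] Γ(E, U)) := by
  have h : U = hU.fromSpec ''ᵁ ⊤ := by simp
  refine ⟨{ restrictAddEquiv hU.fromSpec E h with map_smul' := fun r x ↦ ?_ }⟩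
  have := restrictAddEquiv_fromSpec_smul E hU h le_rfl r x
  have h1 : X.presheaf.map (homOfLE (le_refl U)).op = 𝟙 _ := X.presheaf.map_id _
  rw [h1] at this
  exact this

theorem nonempty_linearEquiv_of_restrict_iso_free {X : Scheme.{u}} (E : X.Modules) {U V : X.Opens}
    (I : Type u) (e : E.restrict U.ι ≅
      (SheafOfModules.free (R := (U : Scheme.{u}).ringCatSheaf) I : (U : Scheme.{u}).Modules))
    (hV : IsAffineOpen V) (hVU : V ≤ U) : Nonempty (Γ(E, V) ≃ₗ[Γ(X, V)] (I →₀ Γ(X, V))) := by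
  let t : Spec Γ(X, V) ⟶ U := hV.isoSpec.inv ≫ X.homOfLE hVU
  have ht : t ≫ U.ι = hV.fromSpec := by simp [t, hV.isoSpec_inv_ι]
  obtain ⟨e₁⟩ := nonempty_linearEquiv_of_iso_free _ I
    ((restrictFunctorCongr ht).symm.app E ≪≫ (restrictFunctorComp t U.ι).app E ≪≫
      (restrictFunctor t).mapIso e ≪≫ restrictFreeIso t I)
  obtain ⟨e₂⟩ := nonempty_linearEquiv_fromSpec E hV
  exact ⟨e₂.symm.trans e₁⟩

theorem restrictAddEquiv_specMap_smul {R S : CommRingCat.{u}} (a : R ⟶ S)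
    [IsOpenImmersion (Spec.map a)] (G : (Spec R).Modules) {V : (Spec S).Opens} {W : (Spec R).Opens}
    (h : W = Spec.map a ''ᵁ V) (r : R) (x : Γ(G.restrict (Spec.map a), V)) :
    restrictAddEquiv (Spec.map a) G h (a r • x) = r • restrictAddEquiv (Spec.map a) G h x := by
  subst h
  have h1 (y : Γ(G, Spec.map a ''ᵁ V)) : (G.presheaf.map (eqToHom rfl : Spec.map a ''ᵁ V ⟶ _).op) y = y := by
    simp
  have := restrictAppIso_smul_Spec (M := G) a r x
  exact (h1 _).trans (this.trans (congrArg (r • ·) (h1 _).symm))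

/-- Sections of a quasi-coherent sheaf over `D(f)` are the localization of its global sections, so a
basis of any model `M'` of that localization trivializes the sheaf there. -/
theorem nonempty_restrict_iso_free_of_isLocalizedModule {R S : CommRingCat.{u}}
    (G : (Spec R).Modules) [G.IsQuasicoherent] (f : R) [Algebra R S] [IsLocalization.Away f S]
    [IsOpenImmersion (Spec.map (CommRingCat.ofHom (algebraMap R S)))]
    {M' : Type u} [AddCommGroup M'] [Module R M'] [Module S M'] [IsScalarTower R S M']
    (l : Γ(G, ⊤) →ₗ[R] M') [IsLocalizedModule (.powers f) l] {I : Type u}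
    (e : M' ≃ₗ[S] (I →₀ S)) :
    Nonempty (G.restrict (Spec.map (CommRingCat.ofHom (algebraMap R S))) ≅
      (SheafOfModules.free (R := (Spec S).ringCatSheaf) I : (Spec S).Modules)) := by
  obtain ⟨D, hDf⟩ : ∃ D : (Spec R).Opens, D = PrimeSpectrum.basicOpen f := ⟨_, rfl⟩
  let ρ : Γ(G, ⊤) →ₗ[R] Γ(G, D) := ((modulesSpecToSheaf.obj G).obj.map D.leTop.op).hom
  have hρ : IsLocalizedModule (.powers f) ρ := by
    subst hDf
    exact (isIso_fromTildeΓ_iff_isLocalizing G).mp inferInstance f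
  have hD : D = Spec.map (CommRingCat.ofHom (algebraMap R S)) ''ᵁ ⊤ := by
    apply TopologicalSpace.Opens.ext
    rw [Scheme.Hom.image_top_eq_opensRange, hDf]
    exact (PrimeSpectrum.localization_away_comap_range S f).symm
  let : Module R Γ(G.restrict (Spec.map (CommRingCat.ofHom (algebraMap R S))), ⊤) :=
    Module.compHom _ (algebraMap R S)
  have : IsScalarTower R S Γ(G.restrict (Spec.map (CommRingCat.ofHom (algebraMap R S))), ⊤) :=
    .of_compHom ..
  let ψ : Γ(G.restrict (Spec.map (CommRingCat.ofHom (algebraMap R S))), ⊤) ≃ₗ[R]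
      Γ(G, D) :=
    { restrictAddEquiv _ G hD with
      map_smul' := restrictAddEquiv_specMap_smul _ G hD }
  let e' := ((IsLocalizedModule.linearEquiv (.powers f) ρ l).symm.trans
      ψ.symm).extendScalarsOfIsLocalization (.powers f) S
  exact nonempty_iso_free_of_linearEquiv _ I (e'.symm.trans e)

/-- A finitely presented flat module is free at the prime of `x`, and freeness spreads to a basic
open set `D(r)` containing `x`. -/
theorem exists_restrict_iso_free_of_flat {X : Scheme.{0}} (E : X.Modules) [E.IsQuasicoherent]
    {U : X.Opens} (hU : IsAffineOpen U) {x : X} (hx : x ∈ U)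
    [Module.FinitePresentation Γ(X, U) Γ(E, U)] [Module.Flat Γ(X, U) Γ(E, U)] :
    ∃ W : X.Opens, x ∈ W ∧ ∃ n : ℕ, Nonempty (E.restrict W.ι ≅
      (SheafOfModules.free (R := (W : Scheme.{0}).ringCatSheaf) (Fin n) :
        (W : Scheme.{0}).Modules)) := by
  let p := (hU.primeIdealOf ⟨x, hx⟩).asIdeal
  have hflat : Module.Flat (Localization.AtPrime p) (LocalizedModule p.primeCompl Γ(E, U)) :=
    Module.Flat.localizedModule _
  have hfree : Module.Free (Localization.AtPrime p) (LocalizedModule p.primeCompl Γ(E, U)) :=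
    Module.free_of_flat_of_isLocalRing
  obtain ⟨r, hr, hfr, -⟩ := Module.FinitePresentation.exists_free_localizedModule_powers
    p.primeCompl (LocalizedModule.mkLinearMap p.primeCompl Γ(E, U)) (Localization.AtPrime p)
  obtain ⟨e₀⟩ := nonempty_linearEquiv_fromSpec E hU
  let S : CommRingCat.{0} := .of (Localization.Away r)
  let : Algebra Γ(X, U) S := inferInstanceAs (Algebra Γ(X, U) (Localization.Away r))
  have : IsLocalization.Away r S := inferInstanceAs (IsLocalization.Away r (Localization.Away r))
  let k : Spec S ⟶ Spec Γ(X, U) := Spec.map (CommRingCat.ofHom (algebraMap Γ(X, U) S))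
  have : IsOpenImmersion k := AlgebraicGeometry.IsOpenImmersion.of_isLocalization r
  let b := (Module.Free.chooseBasis (Localization.Away r)
    (LocalizedModule.Away r Γ(E, U))).reindex (Fintype.equivFin _)
  obtain ⟨e⟩ := nonempty_restrict_iso_free_of_isLocalizedModule (S := S)
    (E.restrict hU.fromSpec) r
    ((LocalizedModule.mkLinearMap (.powers r) Γ(E, U)).comp e₀.toLinearMap) b.repr
  let j := k ≫ hU.fromSpec
  have hj : j.isoOpensRange.inv ≫ j = j.opensRange.ι := j.isoOpensRange_inv_comp
  refine ⟨j.opensRange, ?_, _, ⟨(restrictFunctorCongr hj).symm.app E ≪≫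
    (restrictFunctorComp j.isoOpensRange.inv j).app E ≪≫
    (restrictFunctor j.isoOpensRange.inv).mapIso
      ((restrictFunctorComp k hU.fromSpec).app E ≪≫ e) ≪≫
    restrictFreeIso j.isoOpensRange.inv _⟩⟩
  have h1 : hU.primeIdealOf ⟨x, hx⟩ ∈ Set.range k := by
    have := PrimeSpectrum.localization_away_comap_range S r
    refine (congrArg (_ ∈ ·) this).mpr ?_
    exact hr
  obtain ⟨z, hz⟩ := h1
  refine ⟨z, ?_⟩
  rw [Scheme.Hom.comp_apply, hz]
  exact hU.fromSpec_primeIdealOf ⟨x, hx⟩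

end AlgebraicGeometry.Scheme.Modules

/-! ### Étale coordinates on smooth schemes. -/

namespace AlgebraicGeometry

/-- The structure map from `k` to the sections over `V` of a scheme over `Spec k`. -/
noncomputable def Scheme.Hom.toSections {k : CommRingCat.{u}} {Y : Scheme.{u}} (f : Y ⟶ Spec k)
    (V : Y.Opens) : k ⟶ Γ(Y, V) :=
  (Scheme.ΓSpecIso k).inv ≫ f.appTop ≫ Y.presheaf.map (homOfLE le_top).op

theorem Scheme.Hom.toSections_map {k : CommRingCat.{u}} {Y : Scheme.{u}} (f : Y ⟶ Spec k)
    {V V' : Y.Opens} (h : V' ≤ V) :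
    f.toSections V ≫ Y.presheaf.map (homOfLE h).op = f.toSections V' := by
  simp only [toSections, Category.assoc, ← Functor.map_comp]
  rfl

theorem Scheme.Hom.toSections_app {k : CommRingCat.{u}} {X Y : Scheme.{u}} (p : X ⟶ Y)
    (f : Y ⟶ Spec k) (V : Y.Opens) :
    f.toSections V ≫ p.app V = (p ≫ f).toSections (p ⁻¹ᵁ V) := by
  simp only [toSections, Category.assoc, Scheme.Hom.naturality, Scheme.Hom.comp_appTop]
  rfl

theorem Smooth.smooth_toSections {k : CommRingCat.{u}} {Y : Scheme.{u}}
    (f : Y ⟶ Spec k) [Smooth f] {V : Y.Opens} (hV : IsAffineOpen V) :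
    (f.toSections V).hom.Smooth :=
  RingHom.Smooth.comp (.of_bijective (ConcreteCategory.bijective_of_isIso (Scheme.ΓSpecIso k).inv))
    (f.smooth_appLE (isAffineOpen_top _) hV le_top)

/-- A smooth algebra is standard smooth on some basic open set around each point, hence étale over a
polynomial ring there. The bound `U` lets `V` also trivialize a given bundle. -/
theorem Smooth.exists_etale_mvPolynomial_toSections {k : CommRingCat.{u}} {Y : Scheme.{u}}
    (f : Y ⟶ Spec k) [Smooth f] {y : Y} {U : Y.Opens} (hy : y ∈ U) :
    ∃ V : Y.Opens, IsAffineOpen V ∧ y ∈ V ∧ V ≤ U ∧ ∃ (n : ℕ)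
      (g : MvPolynomial (Fin n) k →+* Γ(Y, V)),
      g.comp MvPolynomial.C = (f.toSections V).hom ∧ g.Etale := by
  obtain ⟨V, hV, hyV, hVU⟩ := exists_isAffineOpen_mem_and_subset hy
  let := (f.toSections V).hom.toAlgebra
  have : Algebra.Smooth k Γ(Y, V) := Smooth.smooth_toSections f hV
  obtain ⟨s, hs, _⟩ := Algebra.IsSmoothAt.exists_notMem_isStandardSmooth (R := k)
    (hV.primeIdealOf ⟨y, hyV⟩).asIdeal
  obtain ⟨n, g, hg, hge⟩ := RingHom.IsStandardSmooth.exists_etale_mvPolynomial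
    (f := algebraMap k (Localization.Away s)) (by rwa [RingHom.isStandardSmooth_algebraMap])
  have := hV.isLocalization_basicOpen s
  let e : Localization.Away s ≃ₐ[Γ(Y, V)] Γ(Y, Y.basicOpen s) :=
    IsLocalization.algEquiv (.powers s) _ _
  refine ⟨Y.basicOpen s, hV.basicOpen s, ?_, (Y.basicOpen_le s).trans hVU, n,
    (e : Localization.Away s →+* Γ(Y, Y.basicOpen s)).comp g, ?_,
    RingHom.Etale.stableUnderComposition _ _ hge (.of_bijective e.bijective)⟩
  · change (⟨y, hyV⟩ : V).1 ∈ Y.basicOpen s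
    rw [← hV.fromSpec_primeIdealOf ⟨y, hyV⟩]
    have : hV.primeIdealOf ⟨y, hyV⟩ ∈ hV.fromSpec ⁻¹ᵁ Y.basicOpen s := by
      rw [hV.fromSpec_preimage_basicOpen]
      exact hs
    exact this
  · rw [RingHom.comp_assoc, hg, IsScalarTower.algebraMap_eq k Γ(Y, V), ← RingHom.comp_assoc]
    have he : (e : Localization.Away s →+* Γ(Y, Y.basicOpen s)).comp (algebraMap Γ(Y, V) _) =
      algebraMap Γ(Y, V) _ := e.toAlgHom.comp_algebraMap
    rw [he, RingHom.algebraMap_toAlgebra, RingHom.algebraMap_toAlgebra]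
    exact congr(($(f.toSections_map (Y.basicOpen_le s))).hom)

end AlgebraicGeometry

/-! ### The theorem for sheaves. -/

open Scheme.Modules in
theorem mainTheorem7
    (X Y : Scheme.{0}) [X.Over (Spec (.of ℂ))] [Y.Over (Spec (.of ℂ))]
    (hX : IsSmoothVariety X) (hY : IsSmoothVariety Y)
    (π : X ⟶ Y) [π.IsOver (Spec (.of ℂ))] (hπ : IsFinite π)
    (E : X.Modules) (hE : IsCoherentSheaf E)
    (hπE : IsVectorBundle ((Scheme.Modules.pushforward π).obj E)) :
    IsVectorBundle E := by
  intro x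
  have := hX.isIntegral
  have := hX.smooth
  have := hY.isIntegral
  have := hY.smooth
  have : E.IsQuasicoherent := hE.isQuasicoherent
  obtain ⟨U, hyU, m, ⟨e⟩⟩ := hπE (π x)
  obtain ⟨V, hV, hyV, hVU, n, g, hg, hge⟩ :=
    Smooth.exists_etale_mvPolynomial_toSections (Y ↘ Spec (.of ℂ)) hyU
  obtain ⟨e'⟩ := nonempty_linearEquiv_of_restrict_iso_free _ _ e hV hVU
  have hW : IsAffineOpen (π ⁻¹ᵁ V) := hV.preimage π
  have : Nonempty V := ⟨_, hyV⟩
  have : Nonempty (π ⁻¹ᵁ V).toScheme := ⟨x, hyV⟩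
  have : IsDomain Γ(Y, V) := IsIntegral.component_integral V
  have : IsDomain Γ(X, π ⁻¹ᵁ V) := IsIntegral.component_integral (π ⁻¹ᵁ V)
  let : Algebra ℂ Γ(Y, V) := ((Y ↘ Spec (.of ℂ)).toSections V).hom.toAlgebra
  let : Algebra ℂ Γ(X, π ⁻¹ᵁ V) := ((X ↘ Spec (.of ℂ)).toSections (π ⁻¹ᵁ V)).hom.toAlgebra
  have : Algebra.Smooth ℂ Γ(X, π ⁻¹ᵁ V) := Smooth.smooth_toSections (X ↘ Spec (.of ℂ)) hW
  let : Algebra Γ(Y, V) Γ(X, π ⁻¹ᵁ V) := (π.app V).hom.toAlgebra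
  have : Module.Finite Γ(Y, V) Γ(X, π ⁻¹ᵁ V) := hπ.finite_app V hV
  have hπY : (Y ↘ Spec (.of ℂ)).toSections V ≫ π.app V =
      (X ↘ Spec (.of ℂ)).toSections (π ⁻¹ᵁ V) := by
    rw [Scheme.Hom.toSections_app, comp_over]
  have : IsScalarTower ℂ Γ(Y, V) Γ(X, π ⁻¹ᵁ V) := .of_algebraMap_eq' congr(($hπY).hom).symm
  let : Module Γ(Y, V) Γ(E, π ⁻¹ᵁ V) := Module.compHom _ (algebraMap Γ(Y, V) Γ(X, π ⁻¹ᵁ V))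
  have : IsScalarTower Γ(Y, V) Γ(X, π ⁻¹ᵁ V) Γ(E, π ⁻¹ᵁ V) := .of_compHom ..
  -- Sections of the pushforward over `V` are by definition those of `E` over the preimage, with
  -- scalars acting through `π`.
  let e'' : Γ(E, π ⁻¹ᵁ V) ≃ₗ[Γ(Y, V)] (Fin m →₀ Γ(Y, V)) := e'
  have : Module.Finite Γ(Y, V) Γ(E, π ⁻¹ᵁ V) := .equiv e''.symm
  have : Module.Flat Γ(Y, V) Γ(E, π ⁻¹ᵁ V) := .of_linearEquiv e''
  have : Module.Finite Γ(X, π ⁻¹ᵁ V) Γ(E, π ⁻¹ᵁ V) := .of_restrictScalars_finite Γ(Y, V) _ _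
  let g' : MvPolynomial (Fin n) ℂ →ₐ[ℂ] Γ(Y, V) := { g with commutes' := fun c ↦ congr($hg c) }
  have : Module.Flat Γ(X, π ⁻¹ᵁ V) Γ(E, π ⁻¹ᵁ V) :=
    Module.flat_of_flat_of_finite_of_smooth g' hge
  have : IsNoetherianRing Γ(X, π ⁻¹ᵁ V) := Algebra.FiniteType.isNoetherianRing ℂ _
  have := Module.finitePresentation_of_finite Γ(X, π ⁻¹ᵁ V) Γ(E, π ⁻¹ᵁ V)
  exact exists_restrict_iso_free_of_flat E hW hyV
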